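/- For $\delta\in\mathbb R$ let $$\lambda(\delta)=\sup\,\mathbb P\bigl(|X-Y|\ge 1-\delta\bigr),\qquad X=\mathbb P(A\mid\mathcal G),\quad Y=\mathbb P(A\mid\mathcal H),$$ where the supremum is taken over all probability spaces $(\Omega,\mathcal F,\mathbb P)$, all events $A\in\mathcal F$ and all sub-$\sigma$-fields $\mathcal G,\mathcal H$ of $\mathcal F$. Then for every $\delta\in(0,1/2)$, $$\lambda(\delta)=\frac{2\delta}{1+\delta}.$$ -/

import Mathlib

open MeasureTheory ProbabilityTheory

universe u

/-- The numbers `P(|X - Y| ≥ 1 - δ)`, where `X = P(A | G)` and `Y = P(A | H)`, for all probability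
spaces `(Ω, mΩ, P)`, all events `A` and all sub-σ-fields `G`, `H` of `mΩ`. Here `P⟦A|G⟧` is the
conditional expectation of the (real-valued) indicator function of `A` given `G`; any other version
of the conditional probability gives the same numbers. -/
def contradictionProbs (δ : ℝ) : Set ℝ :=
  {p | ∃ (Ω : Type u) (G H mΩ : MeasurableSpace Ω) (P : Measure[mΩ] Ω) (A : Set Ω),
    IsProbabilityMeasure P ∧ MeasurableSet[mΩ] A ∧ G ≤ mΩ ∧ H ≤ mΩ ∧
      p = P.real {ω | 1 - δ ≤ |(P⟦A|G⟧) ω - (P⟦A|H⟧) ω|}}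

/-- `λ(δ)`: the supremum of `P(|P(A|G) - P(A|H)| ≥ 1 - δ)`. It is a genuine supremum by
`contradictionProbs_nonempty` and `contradictionProbs_bddAbove`. -/
noncomputable def contradictionSup (δ : ℝ) : ℝ :=
  sSup (contradictionProbs.{u} δ)

theorem contradictionProbs_nonempty (δ : ℝ) : (contradictionProbs.{u} δ).Nonempty :=
  ⟨_, PUnit, ⊤, ⊤, ⊤, @Measure.dirac PUnit ⊤ PUnit.unit, ∅,
    @Measure.dirac.isProbabilityMeasure PUnit ⊤ PUnit.unit,
    @MeasurableSet.empty _ ⊤, le_rfl, le_rfl, rfl⟩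

theorem contradictionProbs_bddAbove (δ : ℝ) : BddAbove (contradictionProbs.{u} δ) := by
  refine ⟨1, ?_⟩
  rintro p ⟨Ω, G, H, mΩ, P, A, hP, -, -, -, rfl⟩
  exact measureReal_le_one

/-! Upper bound: for `φ = dualWeight δ`, `φ(X)(1_A - X)` has mean zero because `φ(X)` is
`G`-measurable, and likewise for `Y`. Integrating the pointwise inequality `indicator_le_dualWeight`
at `x = X`, `y = Y`, `t = 1_A` leaves `(1 + δ) P(D) ≤ 2δ`, where `D` is the event in question.
Equality is attained on three points: each σ-field isolates one of the two points of `A`, so on `A`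
one opinion is `1` and the other `δ`. -/

/-- Weights witnessing, by linear programming duality, the bound on the probability that two
coherent opinions differ by at least `1 - δ`. -/
noncomputable def dualWeight (δ x : ℝ) : ℝ :=
  (Set.Iic δ).indicator 1 x - (Set.Ici (1 - δ)).indicator 1 x

/-- Each product is at least `-δ`, which covers `|x - y| < 1 - δ`. Otherwise one of `x`, `y` is at
most `δ` and the other at least `1 - δ`; the weights are opposite, `t` cancels, and the products sum
to `|x - y|`. -/
theorem indicator_le_dualWeight {δ x y t : ℝ} (hδ : 0 < δ) (hδ' : δ < 1 / 2)
    (hx : x ∈ Set.Icc (0 : ℝ) 1) (hy : y ∈ Set.Icc (0 : ℝ) 1) (ht : t = 0 ∨ t = 1) :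
    (1 + δ) * (if 1 - δ ≤ |x - y| then 1 else 0) ≤
      2 * δ + dualWeight δ x * (t - x) + dualWeight δ y * (t - y) := by
  obtain ⟨hx0, hx1⟩ := hx
  obtain ⟨hy0, hy1⟩ := hy
  simp only [dualWeight, Set.indicator_apply, Set.mem_Iic, Set.mem_Ici, Pi.one_apply, le_abs]
  rcases ht with rfl | rfl <;> split_ifs with h <;>
    first | linarith | (rcases h with h | h <;> linarith)

section ConditionalProbability

variable {Ω : Type*} {G H mΩ : MeasurableSpace Ω} {P : Measure Ω} [IsProbabilityMeasure P]
  {A : Set Ω}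

theorem condProb_mem_Icc (hG : G ≤ mΩ) (hA : MeasurableSet A) :
    ∀ᵐ ω ∂P, (P⟦A|G⟧) ω ∈ Set.Icc (0 : ℝ) 1 := by
  have hint : Integrable (A.indicator fun _ => (1 : ℝ)) P := (integrable_const 1).indicator hA
  have h0 : 0 ≤ᵐ[P] P⟦A|G⟧ :=
    condExp_nonneg (ae_of_all _ fun ω => Set.indicator_nonneg (fun _ _ => zero_le_one) ω)
  have h1 : P⟦A|G⟧ ≤ᵐ[P] P[fun _ => (1 : ℝ)|G] :=
    condExp_mono hint (integrable_const 1)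
      (ae_of_all _ fun ω => Set.indicator_le_self' (fun _ _ => zero_le_one) ω)
  rw [condExp_const hG] at h1
  filter_upwards [h0, h1] with ω a b using ⟨a, b⟩

theorem integrable_and_integral_dualWeight (δ : ℝ) (hG : G ≤ mΩ) (hA : MeasurableSet A) :
    Integrable (fun ω => dualWeight δ ((P⟦A|G⟧) ω) *
      (A.indicator (fun _ => (1 : ℝ)) ω - (P⟦A|G⟧) ω)) P ∧
    ∫ ω, dualWeight δ ((P⟦A|G⟧) ω) *
      (A.indicator (fun _ => (1 : ℝ)) ω - (P⟦A|G⟧) ω) ∂P = 0 := by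
  set f : Ω → ℝ := A.indicator fun _ => (1 : ℝ) with hf
  have hint : Integrable f P := (integrable_const 1).indicator hA
  have hdiff : Integrable (fun ω => f ω - (P⟦A|G⟧) ω) P := hint.sub integrable_condExp
  have hX : Measurable[G] (P⟦A|G⟧) := stronglyMeasurable_condExp.measurable
  have key : ∀ s, MeasurableSet[G] s →
      Integrable (s.indicator fun ω => f ω - (P⟦A|G⟧) ω) P ∧
        ∫ ω, s.indicator (fun ω => f ω - (P⟦A|G⟧) ω) ω ∂P = 0 := by
    intro s hs
    refine ⟨hdiff.indicator (hG s hs), ?_⟩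
    rw [integral_indicator (hG s hs),
      integral_sub hint.integrableOn integrable_condExp.integrableOn,
      setIntegral_condExp hG hint hs, sub_self]
  obtain ⟨i1, e1⟩ := key _ (hX (measurableSet_Iic (a := δ)))
  obtain ⟨i2, e2⟩ := key _ (hX (measurableSet_Ici (a := 1 - δ)))
  have heq : (fun ω => dualWeight δ ((P⟦A|G⟧) ω) * (f ω - (P⟦A|G⟧) ω)) = fun ω =>
      ((P⟦A|G⟧) ⁻¹' Set.Iic δ).indicator (fun ω => f ω - (P⟦A|G⟧) ω) ω -
        ((P⟦A|G⟧) ⁻¹' Set.Ici (1 - δ)).indicator (fun ω => f ω - (P⟦A|G⟧) ω) ω := by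
    funext ω
    by_cases h1 : (P⟦A|G⟧) ω ≤ δ <;> by_cases h2 : 1 - δ ≤ (P⟦A|G⟧) ω <;>
      simp [dualWeight, h1, h2]
  rw [heq]
  exact ⟨i1.sub i2, by rw [integral_sub i1 i2, e1, e2, sub_zero]⟩

theorem condProb_generateFrom_singleton {s : Set Ω} (hs : MeasurableSet s) (hA : MeasurableSet A)
    {ω : Ω} (hω : ω ∈ s) (hPω : P {ω} ≠ 0) :
    (P⟦A|MeasurableSpace.generateFrom {s}⟧) ω = (P.real s)⁻¹ * P.real (s ∩ A) := by
  have h := condExp_generateFrom_singleton (μ := P) hs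
    ((integrable_const (1 : ℝ)).indicator hA)
  rw [Filter.EventuallyEq, ae_restrict_iff' hs, ae_iff] at h
  by_contra hne
  -- An almost sure identity holds at every point of positive mass.
  refine hPω (measure_mono_null (Set.singleton_subset_iff.2 ?_) h)
  intro hc
  apply hne
  rw [hc hω, integral_indicator_const _ hA, smul_eq_mul, mul_one, measureReal_def, cond_apply hs,
    ENNReal.toReal_mul, ENNReal.toReal_inv, measureReal_def, measureReal_def]

theorem generateFrom_singleton_compl (s : Set Ω) :
    MeasurableSpace.generateFrom {sᶜ} = MeasurableSpace.generateFrom {s} := by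
  apply le_antisymm <;> refine MeasurableSpace.generateFrom_le ?_ <;> intro t ht <;>
    rw [Set.mem_singleton_iff.1 ht]
  · exact (MeasurableSpace.measurableSet_generateFrom (Set.mem_singleton s)).compl
  · exact MeasurableSet.compl_iff.1
      (MeasurableSpace.measurableSet_generateFrom (Set.mem_singleton sᶜ))

theorem condProb_generateFrom_singleton_of_notMem {s : Set Ω} (hs : MeasurableSet s)
    (hA : MeasurableSet A) {ω : Ω} (hω : ω ∉ s) (hPω : P {ω} ≠ 0) :
    (P⟦A|MeasurableSpace.generateFrom {s}⟧) ω = (P.real sᶜ)⁻¹ * P.real (sᶜ ∩ A) := by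
  rw [← generateFrom_singleton_compl s]
  exact condProb_generateFrom_singleton hs.compl hA hω hPω

theorem measureReal_condProb_diff_le {δ : ℝ} (hδ : 0 < δ)
    (hδ' : δ < 1 / 2) (hG : G ≤ mΩ) (hH : H ≤ mΩ) (hA : MeasurableSet A) :
    P.real {ω | 1 - δ ≤ |(P⟦A|G⟧) ω - (P⟦A|H⟧) ω|} ≤ 2 * δ / (1 + δ) := by
  have hX : Measurable (P⟦A|G⟧) := (stronglyMeasurable_condExp.mono hG).measurable
  have hY : Measurable (P⟦A|H⟧) := (stronglyMeasurable_condExp.mono hH).measurable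
  set D : Set Ω := {ω | 1 - δ ≤ |(P⟦A|G⟧) ω - (P⟦A|H⟧) ω|} with hD
  have hDm : MeasurableSet D := measurableSet_le measurable_const (hX.sub hY).abs
  obtain ⟨iX, eX⟩ := integrable_and_integral_dualWeight (P := P) δ hG hA
  obtain ⟨iY, eY⟩ := integrable_and_integral_dualWeight (P := P) δ hH hA
  have hle := integral_mono_ae (((integrable_const (1 : ℝ)).indicator hDm).const_mul (1 + δ))
    (((integrable_const (2 * δ)).add iX).add iY) (μ := P) (by
      filter_upwards [condProb_mem_Icc (P := P) hG hA, condProb_mem_Icc (P := P) hH hA]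
        with ω hx hy
      have ht : A.indicator (fun _ => (1 : ℝ)) ω = 0 ∨ A.indicator (fun _ => (1 : ℝ)) ω = 1 := by
        by_cases h : ω ∈ A <;> simp [h]
      simpa only [Set.indicator_apply, hD, Set.mem_ofPred_eq, Pi.add_apply] using
        indicator_le_dualWeight hδ hδ' hx hy ht)
  rw [integral_const_mul, integral_indicator_const _ hDm,
    integral_add' ((integrable_const _).add iX) iY, integral_add' (integrable_const _) iX,
    eX, eY] at hle
  rw [le_div_iff₀ (by linarith)]
  simp only [integral_const, probReal_univ, smul_eq_mul] at hle
  linarith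

end ConditionalProbability

/-- The sample space of the extremal example. -/
inductive ThreePoint : Type u
  | first
  | second
  | third

namespace ThreePoint

instance : MeasurableSpace ThreePoint.{u} := ⊤

instance : DiscreteMeasurableSpace ThreePoint.{u} := ⟨fun _ => trivial⟩

/-- Mass `a` at each of the first two points, and the remaining mass at the third. -/
noncomputable def prob (a : ℝ) : Measure ThreePoint.{u} :=
  ENNReal.ofReal a • Measure.dirac first + ENNReal.ofReal a • Measure.dirac second +
    ENNReal.ofReal (1 - 2 * a) • Measure.dirac third

theorem prob_real {a : ℝ} (ha : 0 ≤ a) (ha' : a ≤ 1 / 2) (s : Set ThreePoint.{u}) :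
    (prob a).real s = a * s.indicator 1 first + a * s.indicator 1 second +
      (1 - 2 * a) * s.indicator 1 third := by
  have h : 0 ≤ 1 - 2 * a := by linarith
  classical
  simp only [prob, Measure.real, Measure.add_apply, Measure.smul_apply,
    Measure.dirac_apply, smul_eq_mul, Set.indicator_apply, Pi.one_apply]
  split_ifs <;> simp [ENNReal.toReal_add, ha, h]

theorem isProbabilityMeasure_prob {a : ℝ} (ha : 0 ≤ a) (ha' : a ≤ 1 / 2) :
    IsProbabilityMeasure (prob.{u} a) := by
  have h := prob_real.{u} ha ha' Set.univ
  simp only [Set.indicator_univ, Pi.one_apply] at h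
  exact ⟨(ENNReal.toReal_eq_one_iff _).1 (h.trans (by ring))⟩

end ThreePoint

open ThreePoint in
theorem exists_le_contradictionProbs {δ : ℝ} (hδ : 0 < δ) (hδ' : δ < 1 / 2) :
    ∃ p ∈ contradictionProbs.{u} δ, 2 * δ / (1 + δ) ≤ p := by
  -- Chosen so that `a / (1 - a) = δ`: this is the conditional probability of `A` off the isolated
  -- point, and `A` has mass `2 * a`.
  set a : ℝ := δ / (1 + δ) with ha_def
  have hpos : 0 < 1 + δ := by linarith
  have ha : 0 < a := by positivity
  have ha2 : a ≤ 1 / 2 := by rw [ha_def, div_le_iff₀ hpos]; linarith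
  have hquot : (a + (1 - 2 * a))⁻¹ * a = δ := by rw [ha_def]; field_simp; ring
  have hP := isProbabilityMeasure_prob.{u} ha.le ha2
  have hreal := prob_real.{u} ha.le ha2
  have hne : ∀ s : Set ThreePoint.{u}, (prob a).real s ≠ 0 → prob a s ≠ 0 := by
    intro s hs h
    simp [Measure.real, h] at hs
  have h1 : prob a {first.{u}} ≠ 0 := hne _ (by rw [hreal]; simp [ha.ne'])
  have h2 : prob a {second.{u}} ≠ 0 := hne _ (by rw [hreal]; simp [ha.ne'])
  set A : Set ThreePoint.{u} := {first, second} with hA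
  have hm : ∀ s : Set ThreePoint.{u}, MeasurableSet s := fun s => .of_discrete
  refine ⟨_, ⟨ThreePoint, MeasurableSpace.generateFrom {{first}},
    MeasurableSpace.generateFrom {{second}}, inferInstance, prob a, A, hP, hm _,
    fun _ _ => hm _, fun _ _ => hm _, rfl⟩, ?_⟩
  have x1 := condProb_generateFrom_singleton (P := prob a) (hm {first}) (hm A)
    (Set.mem_singleton _) h1
  have x2 := condProb_generateFrom_singleton_of_notMem (P := prob a) (s := {first}) (hm _) (hm A)
    (ω := second) (by simp) h2
  have y2 := condProb_generateFrom_singleton (P := prob a) (hm {second}) (hm A)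
    (Set.mem_singleton _) h2
  have y1 := condProb_generateFrom_singleton_of_notMem (P := prob a) (s := {second}) (hm _) (hm A)
    (ω := first) (by simp) h1
  replace x1 := x1.trans (by simp [hreal, hA, ha.ne'] : _ = (1 : ℝ))
  replace y2 := y2.trans (by simp [hreal, hA, ha.ne'] : _ = (1 : ℝ))
  replace x2 := x2.trans (by simp [hreal, hA, hquot] : _ = δ)
  replace y1 := y1.trans (by simp [hreal, hA, hquot] : _ = δ)
  have hsub : A ⊆ {ω | 1 - δ ≤
      |((prob a)⟦A|MeasurableSpace.generateFrom {{first}}⟧) ω -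
        ((prob a)⟦A|MeasurableSpace.generateFrom {{second}}⟧) ω|} := by
    rintro ω (rfl | rfl)
    · rw [Set.mem_ofPred_eq, x1, y1]
      exact le_abs_self _
    · rw [Set.mem_ofPred_eq, x2, y2, abs_sub_comm]
      exact le_abs_self _
  calc 2 * δ / (1 + δ) = (prob a).real A := by
        rw [hreal]; simp [hA, ha_def]; ring
    _ ≤ _ := measureReal_mono hsub

theorem theorem1p1 (δ : ℝ) (hδ : δ ∈ Set.Ioo (0 : ℝ) (1 / 2)) :
    contradictionSup.{u} δ = 2 * δ / (1 + δ) := by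
  obtain ⟨h0, h1⟩ := hδ
  apply le_antisymm
  · refine csSup_le (contradictionProbs_nonempty δ) ?_
    rintro p ⟨Ω, G, H, mΩ, P, A, hP, hA, hG, hH, rfl⟩
    exact measureReal_condProb_diff_le h0 h1 hG hH hA
  · obtain ⟨p, hp, hle⟩ := exists_le_contradictionProbs.{u} h0 h1
    exact hle.trans (le_csSup (contradictionProbs_bddAbove δ) hp)
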